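/- Let $V$ be a finite-dimensional real vector space with a finite increasing filtration $W$, nondegenerate $(-1)^w$-symmetric bilinear forms $\langle\,,\rangle_w$ on $Gr^W_w$, and Hodge numbers $h^{p,q}$; let $\mathcal M$ be the classifying space of mixed Hodge structures $(F,W)$ on $V$ with these Hodge numbers and graded-polarized by these forms, $\check{\mathcal M}$ its compact dual, and $\mathfrak g_{\mathbb C}$ the Lie algebra of the group of automorphisms of $V_{\mathbb C}$ preserving $W$ and the forms on $Gr^W$. Let $U$ be the upper half-plane, $\Delta$ the unit disc, $\Delta^*=\Delta\setminus\{0\}$. Let $\mathcal V\to\Delta^{*r}$ be a variation of graded-polarized mixed Hodge structure with unipotent monodromy, given by a holomorphic horizontal period map $F:U^r\to\mathcal M$ with $F(z+e_j)=e^{N_j}.F(z)$, where $N_1,\dots,N_r\in\mathfrak g_{\mathbb C}$ are real, nilpotent and commute. Put $N(z)=\sum_j z_jN_j$ and $s_j=e^{2\pi i z_j}$. Suppose that $\mathcal V$ is admissible, i.e. the map $\Delta^{*r}\to\check{\mathcal M}$ induced by $z\mapsto e^{-N(z)}.F(z)$ extends holomorphically to $\Delta^r\to\check{\mathcal M}$,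 with value $F_\infty$ at $0$ (the limit Hodge filtration); the relative weight filtrations $M(N_j,W)$ exist; and there is one filtration $M$ which is the relative weight filtration $M(N,W)$ for every $N$ in the open cone $\{\sum_j\lambda_jN_j\mid\lambda_j>0\}$. Let $V_{\mathbb C}=\bigoplus I^{p,q}$ be the Deligne bigrading of the limit mixed Hodge structure $(F_\infty,M)$, let $\mathfrak g^{a,b}$ be the set of $X\in\mathfrak g_{\mathbb C}$ with $X(I^{p,q})\subseteq I^{p+a,q+b}$ for all $p,q$, and $\mathfrak q=\bigoplus_{a<0,\,b}\mathfrak g^{a,b}$. Let $$F(z)=e^{N(z)}e^{\Gamma(s)}.F_\infty$$ be the local normal form of the period map near $s=0$, where $\Gamma$ is a $\mathfrak q$-valued holomorphic function on a polydisc around $0\in\mathbb C^r$ with $\Gamma(0)=0$. Then for any choice of values $z_j=z_j(s)$ of $\frac{1}{2\pi i}\log s_j$, for $s\in\Delta^{*r}$ near $0$, with $|\mathrm{Re}\,z_j(s)|\le C\,(1+|\log|s_j||)^k$ for some constants $C$ and $k$ (for instance, branches of the logarithm with branch cuts along rays, for which $\mathrm{Re}\,z_j$ is bounded), one has $$\lim_{s\to0,\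 s\in\Delta^{*r}}\mathrm{Ad}\big(e^{\sum_j z_jN_j}\big)\,\Gamma(s)=0 .$$ -/

import Mathlib

open Filter Topology

noncomputable section

namespace HodgeLimit

variable {E : Type*} [NormedAddCommGroup E] [NormedSpace ℂ E] {r : ℕ}

/-- The discrete data of a classifying space of graded-polarized mixed Hodge structures.
`E` is the complexification of the real vector space `V`, which is recovered as the fixed
space of `conj`. The weight filtration `W` of `V` is given by the `conj`-stable subspaces
`W k` of `E`. The form `Q w` on `Gr^W_w` is given by its pull-back to `W w`: a bilinear form
whose radical is exactly `W (w - 1)`. -/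
structure PolarizedData (E : Type*) [NormedAddCommGroup E] [NormedSpace ℂ E] where
  conj : E →ₛₗ[starRingEnd ℂ] E
  conj_conj : ∀ v, conj (conj v) = v
  W : ℤ → Submodule ℂ E
  W_mono : Monotone W
  W_bot : ∃ k, W k = ⊥
  W_top : ∃ k, W k = ⊤
  W_conj : ∀ k, ∀ v ∈ W k, conj v ∈ W k
  Q : (w : ℤ) → ↥(W w) →ₗ[ℂ] ↥(W w) →ₗ[ℂ] ℂ
  Q_symm : ∀ w u v, Q w v u = (-1 : ℂ) ^ w * Q w u v
  Q_real : ∀ w (u v : ↥(W w)),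
    Q w ⟨conj u, W_conj w u u.2⟩ ⟨conj v, W_conj w v v.2⟩ = starRingEnd ℂ (Q w u v)
  Q_nondeg : ∀ w (u : ↥(W w)), (∀ v, Q w u v = 0) ↔ (u : E) ∈ W (w - 1)
  /-- the Hodge numbers; `h p q` belongs to the weight `w = p + q` -/
  h : ℤ → ℤ → ℕ
  h_symm : ∀ p q, h p q = h q p
  h_finite : ∀ w, {p : ℤ | h p (w - p) ≠ 0}.Finite
  h_sum : ∀ w, Module.finrank ℂ (W w) = Module.finrank ℂ (W (w - 1)) + ∑ᶠ p, h p (w - p)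

namespace PolarizedData

variable (D : PolarizedData E)

/-- The subspace of `Gr^W_w` induced by `A ⊆ E`, represented by its preimage in `W w`. -/
def ind (A : Submodule ℂ E) (w : ℤ) : Submodule ℂ E := (A ⊓ D.W w) ⊔ D.W (w - 1)

/-- The complex conjugate of a subspace (`conj` is an involution). -/
def conjSub (A : Submodule ℂ E) : Submodule ℂ E := A.comap D.conj

/-- Points of the compact dual of the classifying space: finite decreasing filtrations of `E`
which induce on each `Gr^W_w` a filtration with the given Hodge numbers that satisfies the first
bilinear relation. -/
structure InCompactDual (F : ℤ → Submodule ℂ E) : Prop where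
  anti : Antitone F
  top : ∃ p, F p = ⊤
  bot : ∃ p, F p = ⊥
  dim : ∀ w p, Module.finrank ℂ (D.ind (F p) w)
    = Module.finrank ℂ (D.ind (F (p + 1)) w) + D.h p (w - p)
  orth : ∀ w p q, w < p + q → ∀ u v : ↥(D.W w),
    (u : E) ∈ D.ind (F p) w → (v : E) ∈ D.ind (F q) w → D.Q w u v = 0

/-- Points of the classifying space: `(F, W)` is a mixed Hodge structure, i.e.
`Gr^W_w = F^p ⊕ conj F^{w+1-p}` for all `w`, `p`, with the given Hodge numbers, and each
`Gr^W_w` is polarized by `Q w`: on `H^{p,q} = F^p ∩ conj F^q`, `p + q = w`, the hermitian form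
`i^{p-q} Q(u, conj u)` is positive definite. -/
structure InClassifyingSpace (F : ℤ → Submodule ℂ E) : Prop extends D.InCompactDual F where
  disjoint : ∀ w p, D.ind (F p) w ⊓ D.ind (D.conjSub (F (w + 1 - p))) w = D.W (w - 1)
  span : ∀ w p, D.ind (F p) w ⊔ D.ind (D.conjSub (F (w + 1 - p))) w = D.W w
  pos : ∀ w p q, p + q = w → ∀ u : ↥(D.W w),
    (u : E) ∈ D.ind (F p) w → (u : E) ∈ D.ind (D.conjSub (F q)) w → (u : E) ∉ D.W (w - 1) →
    0 < (Complex.I ^ (p - q) * D.Q w u ⟨D.conj u, D.W_conj w u u.2⟩).re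

/-- The Lie algebra of the complex group of automorphisms of `E` which preserve `W` and act on
each `Gr^W_w` by isometries of `Q w`. -/
def lieG : Submodule ℂ (E →L[ℂ] E) where
  carrier := {X | ∃ hX : ∀ w, ∀ v ∈ D.W w, X v ∈ D.W w, ∀ w (u v : ↥(D.W w)),
    D.Q w ⟨X u, hX w u u.2⟩ v + D.Q w u ⟨X v, hX w v v.2⟩ = 0}
  zero_mem' := by
    refine ⟨fun w v _ => by simp, fun w u v => ?_⟩
    have h0 : ∀ h : (0 : E) ∈ D.W w, (⟨0, h⟩ : ↥(D.W w)) = 0 := fun _ => rfl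
    simp [h0]
  add_mem' := by
    rintro X Y ⟨hX, hX'⟩ ⟨hY, hY'⟩
    refine ⟨fun w v hv => (D.W w).add_mem (hX w v hv) (hY w v hv), fun w u v => ?_⟩
    have key : ∀ x : ↥(D.W w), ∀ h, (⟨(X + Y) x, h⟩ : ↥(D.W w))
        = ⟨X x, hX w x x.2⟩ + ⟨Y x, hY w x x.2⟩ := fun _ _ => rfl
    rw [key, key, map_add, map_add, LinearMap.add_apply]
    linear_combination hX' w u v + hY' w u v
  smul_mem' := by
    rintro c X ⟨hX, hX'⟩
    refine ⟨fun w v hv => (D.W w).smul_mem c (hX w v hv), fun w u v => ?_⟩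
    have key : ∀ x : ↥(D.W w), ∀ h, (⟨(c • X) x, h⟩ : ↥(D.W w))
        = c • ⟨X x, hX w x x.2⟩ := fun _ _ => rfl
    rw [key, key, map_smul, map_smul, LinearMap.smul_apply, smul_eq_mul, smul_eq_mul]
    linear_combination c * hX' w u v

end PolarizedData

/-- The product of upper half-planes. -/
def upperHalf (r : ℕ) : Set (Fin r → ℂ) := {z | ∀ j, 0 < (z j).im}

/-- The open polydisc of radius `ρ`. -/
def polydisc (r : ℕ) (ρ : ℝ) : Set (Fin r → ℂ) := {s | ∀ j, ‖s j‖ < ρ}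

/-- The product of punctured unit discs. -/
def puncturedPolydisc (r : ℕ) : Set (Fin r → ℂ) := {s | ∀ j, s j ≠ 0 ∧ ‖s j‖ < 1}

/-- The covering map `s_j = exp(2 π i z_j)`. -/
def cover (z : Fin r → ℂ) : Fin r → ℂ := fun j => Complex.exp (2 * Real.pi * Complex.I * z j)

/-- `N(z) = ∑ z_j N_j`. -/
def monoSum (N : Fin r → E →L[ℂ] E) (z : Fin r → ℂ) : E →L[ℂ] E := ∑ j, z j • N j

/-- The action of an endomorphism on (the members of) a filtration. -/
def act (g : E →L[ℂ] E) (A : Submodule ℂ E) : Submodule ℂ E := A.map (g : E →ₗ[ℂ] E)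

/-- Holomorphy on `O` of a map into a variety of flags of `E`, which is a homogeneous space of
`GL(E)`: locally the map is given by letting a holomorphic `GL(E)`-valued function act on a
fixed flag. -/
def HolomorphicFlag (O : Set (Fin r → ℂ)) (F : (Fin r → ℂ) → ℤ → Submodule ℂ E) : Prop :=
  ∀ z₀ ∈ O, ∃ g : (Fin r → ℂ) → E →L[ℂ] E, ∀ᶠ z in 𝓝 z₀,
    DifferentiableAt ℂ g z ∧ IsUnit (g z) ∧ ∀ p, F z p = act (g z) (F z₀ p)

/-- Griffiths horizontality on `O`: partial derivatives of holomorphic sections of `F^p` are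
sections of `F^{p-1}`. -/
def Horizontal (O : Set (Fin r → ℂ)) (F : (Fin r → ℂ) → ℤ → Submodule ℂ E) : Prop :=
  ∀ (p : ℤ) (O' : Set (Fin r → ℂ)), IsOpen O' → O' ⊆ O → ∀ v : (Fin r → ℂ) → E,
    DifferentiableOn ℂ v O' → (∀ z ∈ O', v z ∈ F z p) →
    ∀ z ∈ O', ∀ j, fderiv ℂ v z (Pi.single j 1) ∈ F z (p - 1)

/-- A variation of graded-polarized mixed Hodge structure over the product of `r` punctured
discs with unipotent monodromy: its period map `F`, lifted to the product of upper half-planes,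
and the logarithms `N j` of its local monodromy transformations `T_j = exp (N j)`. -/
structure Variation (D : PolarizedData E) (r : ℕ) where
  N : Fin r → E →L[ℂ] E
  N_mem : ∀ j, N j ∈ D.lieG
  N_real : ∀ j v, N j (D.conj v) = D.conj (N j v)
  N_nilp : ∀ j, IsNilpotent (N j)
  N_comm : ∀ i j, Commute (N i) (N j)
  F : (Fin r → ℂ) → ℤ → Submodule ℂ E
  F_mem : ∀ z ∈ upperHalf r, D.InClassifyingSpace (F z)
  F_holo : HolomorphicFlag (upperHalf r) F
  F_horiz : Horizontal (upperHalf r) F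
  F_mono : ∀ z ∈ upperHalf r, ∀ j p,
    F (z + Pi.single j 1) p = act (NormedSpace.exp (N j)) (F z p)

/-- `M` is the relative weight filtration `M(N, W)`: `N M_k ⊆ M_{k-2}`, and `M` induces on each
`Gr^W_w` the monodromy weight filtration of `N` centered at `w`, i.e. `N^l` induces isomorphisms
`Gr^M_{w+l} Gr^W_w → Gr^M_{w-l} Gr^W_w`. -/
structure IsRelativeWeight (D : PolarizedData E) (N : E →L[ℂ] E) (M : ℤ → Submodule ℂ E) :
    Prop where
  mono : Monotone M
  bot : ∃ k, M k = ⊥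
  top : ∃ k, M k = ⊤
  shift : ∀ k, ∀ v ∈ M k, N v ∈ M (k - 2)
  inj : ∀ (w : ℤ) (l : ℕ), ∀ x ∈ D.ind (M (w + l)) w,
    (N ^ l) x ∈ D.ind (M (w - l - 1)) w → x ∈ D.ind (M (w + l - 1)) w
  surj : ∀ (w : ℤ) (l : ℕ), ∀ y ∈ D.ind (M (w - l)) w,
    ∃ x ∈ D.ind (M (w + l)) w, y - (N ^ l) x ∈ D.ind (M (w - l - 1)) w

/-- `Finf` is the limit Hodge filtration of the variation: the map induced by
`z ↦ exp(-N(z)) F(z)` on the product of punctured discs extends to a holomorphic map from the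
unit polydisc to the compact dual, with value `Finf` at the origin. -/
def Variation.IsLimit {D : PolarizedData E} (𝒱 : Variation D r) (Finf : ℤ → Submodule ℂ E) :
    Prop :=
  ∃ ψ : (Fin r → ℂ) → ℤ → Submodule ℂ E,
    HolomorphicFlag (polydisc r 1) ψ ∧
    (∀ s ∈ polydisc r 1, D.InCompactDual (ψ s)) ∧
    (∀ z ∈ upperHalf r, ∀ p,
      ψ (cover z) p = act (NormedSpace.exp (-monoSum 𝒱.N z)) (𝒱.F z p)) ∧
    ψ 0 = Finf

/-- The variation is admissible, with limit Hodge filtration `Finf` and monodromy weight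
filtration `M`: the limit Hodge filtration exists and equals `Finf`, the relative weight
filtrations `M(N_j, W)` exist, and `M` is the relative weight filtration `M(N, W)` of
every `N` in the open monodromy cone `{∑ λ_j N_j | λ_j > 0}`. -/
structure Variation.IsAdmissible {D : PolarizedData E} (𝒱 : Variation D r)
    (Finf M : ℤ → Submodule ℂ E) : Prop where
  limit : 𝒱.IsLimit Finf
  rel_each : ∀ j, ∃ M', IsRelativeWeight D (𝒱.N j) M'
  rel_cone : ∀ lam : Fin r → ℝ, (∀ j, 0 < lam j) →
    IsRelativeWeight D (monoSum 𝒱.N (fun j => (lam j : ℂ))) M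

/-- `I` is the Deligne bigrading of the mixed Hodge structure `(F, M)`. -/
structure IsDeligneBigrading (D : PolarizedData E) (F M : ℤ → Submodule ℂ E)
    (I : ℤ → ℤ → Submodule ℂ E) : Prop where
  internal : DirectSum.IsInternal (fun a : ℤ × ℤ => I a.1 a.2)
  hodge : ∀ p, F p = ⨆ (a : ℤ) (b : ℤ) (_ : p ≤ a), I a b
  weight : ∀ k, M k = ⨆ (a : ℤ) (b : ℤ) (_ : a + b ≤ k), I a b
  conj : ∀ p q, I p q ⊔ (⨆ (a : ℤ) (b : ℤ) (_ : a < p ∧ b < q), I a b)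
    = D.conjSub (I q p) ⊔ (⨆ (a : ℤ) (b : ℤ) (_ : a < p ∧ b < q), I a b)

/-- The component `𝔤^{a,b}` of the Lie algebra. -/
def gPiece (D : PolarizedData E) (I : ℤ → ℤ → Submodule ℂ E) (a b : ℤ) :
    Submodule ℂ (E →L[ℂ] E) where
  carrier := {X | X ∈ D.lieG ∧ ∀ p q, ∀ v ∈ I p q, X v ∈ I (p + a) (q + b)}
  zero_mem' := ⟨D.lieG.zero_mem, fun p q v _ => by simp⟩
  add_mem' := fun hX hY => ⟨D.lieG.add_mem hX.1 hY.1,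
    fun p q v hv => (I (p + a) (q + b)).add_mem (hX.2 p q v hv) (hY.2 p q v hv)⟩
  smul_mem' := fun c _ hX => ⟨D.lieG.smul_mem c hX.1,
    fun p q v hv => (I (p + a) (q + b)).smul_mem c (hX.2 p q v hv)⟩

/-- `𝔮 = ⊕_{a < 0, b} 𝔤^{a,b}`. -/
def qSub (D : PolarizedData E) (I : ℤ → ℤ → Submodule ℂ E) : Submodule ℂ (E →L[ℂ] E) :=
  ⨆ (a : ℤ) (b : ℤ) (_ : a < 0), gPiece D I a b

/-- `Γ` gives the local normal form `F(z) = exp(N(z)) exp(Γ(s)) Finf` of the period map near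
`s = 0`: it is holomorphic and `𝔮`-valued near the origin, and vanishes there. -/
def Variation.IsLocalNormalForm {D : PolarizedData E} (𝒱 : Variation D r)
    (Finf : ℤ → Submodule ℂ E) (I : ℤ → ℤ → Submodule ℂ E)
    (Γ : (Fin r → ℂ) → E →L[ℂ] E) : Prop :=
  Γ 0 = 0 ∧ ∃ ρ : ℝ, 0 < ρ ∧
    DifferentiableOn ℂ Γ (polydisc r ρ) ∧
    (∀ s ∈ polydisc r ρ, Γ s ∈ qSub D I) ∧
    ∀ z ∈ upperHalf r, cover z ∈ polydisc r ρ → ∀ p,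
      𝒱.F z p = act (NormedSpace.exp (monoSum 𝒱.N z) * NormedSpace.exp (Γ (cover z))) (Finf p)

/-- `Ad(exp X) Y = exp(X) Y exp(-X)`. -/
def adExp (X Y : E →L[ℂ] E) : E →L[ℂ] E := NormedSpace.exp X * Y * NormedSpace.exp (-X)

/-- A choice, for `s` near `0` in the product of punctured discs, of values
`z_j(s) = log(s_j) / (2 π i)` whose arguments `2 π Re z_j(s)` grow at most like a power of
`log |s_j|`. For branches of the logarithm cut along rays, the arguments are bounded. -/
def IsBranchChoice (z : (Fin r → ℂ) → Fin r → ℂ) : Prop :=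
  (∀ᶠ s in 𝓝[puncturedPolydisc r] 0, cover (z s) = s) ∧
  ∃ (C : ℝ) (k : ℕ), ∀ᶠ s in 𝓝[puncturedPolydisc r] 0, ∀ j,
    |(z s j).re| ≤ C * (1 + |Real.log ‖s j‖|) ^ k

end HodgeLimit

end

open HodgeLimit

namespace HodgeLimit

/-! ### Exponentials of nilpotent elements -/

section Exponential

open Polynomial

/-! The point is that `Γ s` commutes with `N j` whenever `s j = 0`. Inserting the normal form into
Griffiths horizontality and letting `s j → 0` kills the term with the derivative of `exp Γ`, which
carries the factor `s j`. What remains says that `exp (-Γ) N_j exp Γ` shifts `Finf` by `-1`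
(`residue_horizontal`); at `s = 0` this holds for `N j` itself. Being real and shifting `M` by `-2`,
`N j` also lowers by one the increasing filtration `opposite`, given by the first index of the
Deligne bigrading (`map_opposite`). As `Γ s` lies in `𝔮`, it lowers `opposite` too, so `exp (-Γ) N_j
exp Γ - N_j` lowers it by two while shifting `Finf` by only `-1`; hence it is zero
(`commute_of_conj_shift`).

The limit is then elementary. `Ad (exp (z_j N_j))` fixes the restriction of `Γ` to `s j = 0`, and
the remainder is `O(‖s j‖)` by the Schwarz lemma. Since `N j` is nilpotent, `Ad (exp (z_j N_j))`
grows polynomially in `z_j`, thus in `log ‖s j‖`, and `‖s j‖` wins. `norm_adExp_sum_le` does this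
for all variables by induction. -/

theorem exp_eq_sum_of_pow_eq_zero {A : Type*} [NormedRing A] [NormedAlgebra ℂ A] {a : A} {m : ℕ}
    (h : a ^ m = 0) : NormedSpace.exp a = ∑ n ∈ Finset.range m, ((n.factorial : ℂ)⁻¹) • a ^ n := by
  rw [NormedSpace.exp_eq_tsum ℂ]
  refine tsum_eq_sum fun n hn => ?_
  rw [pow_eq_zero_of_le (by simpa using hn) h, smul_zero]

/-- Modulo higher powers of `a`, the `n`-th power of `a + a² q(a)` is `a ^ n`. Descending induction
on `n`, starting from `a ^ m = 0`, thus shows that every `a ^ n` with `n ≥ 1` commutes with `b`. -/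
theorem commute_of_commute_aeval {A : Type*} [Ring A] [Algebra ℂ A] {a b : A}
    (ha : IsNilpotent a) (q : ℂ[X]) (h : Commute (aeval a (X + X ^ 2 * q)) b) : Commute a b := by
  obtain ⟨m, hm⟩ := ha
  have tail : ∀ k, (∀ n, k ≤ n → Commute (a ^ n) b) →
      ∀ r : ℂ[X], Commute (aeval a (X ^ k * r)) b := by
    intro k hk r
    induction r using Polynomial.induction_on' with
    | add p q hp hq => rw [mul_add, map_add]; exact hp.add_left hq
    | monomial n c =>
      have : aeval a (X ^ k * monomial n c) = c • a ^ (k + n) := by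
        rw [map_mul, aeval_monomial, ← Algebra.smul_def, mul_smul_comm, map_pow, aeval_X, pow_add]
      rw [this]
      exact (hk _ (by omega)).smul_left c
  have step : ∀ d, ∀ n, 1 ≤ n → m ≤ n + d → Commute (a ^ n) b := by
    intro d
    induction d with
    | zero => intro n _ hn; rw [pow_eq_zero_of_le (by omega) hm]; exact Commute.zero_left b
    | succ d ih =>
      intro n hn1 hn
      obtain ⟨r, hr⟩ := sub_dvd_pow_sub_pow (1 + X * q) 1 n
      have key : (X : ℂ[X]) ^ n = (X + X ^ 2 * q) ^ n - X ^ (n + 1) * (q * r) := by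
        have h1 : (X + X ^ 2 * q : ℂ[X]) ^ n = X ^ n * (1 + X * q) ^ n := by
          rw [← mul_pow]; ring
        rw [one_pow] at hr
        rw [h1, show (1 + X * q) ^ n = 1 + (1 + X * q - 1) * r by rw [← hr]; ring]
        ring
      have h2 : a ^ n = aeval a ((X : ℂ[X]) ^ n) := by simp
      rw [h2, key, map_sub, map_pow]
      exact (h.pow_left n).sub_left (tail _ (fun k hk => ih k (by omega) (by omega)) _)
  simpa using step m 1 le_rfl (by omega)

/-- For nilpotent `a`, `exp a - 1` has the form `a + a² q(a)`, so no logarithm is needed. -/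
theorem commute_of_commute_exp {A : Type*} [NormedRing A] [NormedAlgebra ℂ A] {a b : A}
    (ha : IsNilpotent a) (h : Commute (NormedSpace.exp a) b) : Commute a b := by
  obtain ⟨m, hm⟩ := ha
  -- The two extra terms are the constant and the linear one, split off from the series below.
  have hm2 : a ^ (m + 2) = 0 := pow_eq_zero_of_le (by omega) hm
  refine commute_of_commute_aeval ⟨m, hm⟩
    (∑ n ∈ Finset.range m, C (((n + 2).factorial : ℂ)⁻¹) * X ^ n) ?_
  have : aeval a (X + X ^ 2 * ∑ n ∈ Finset.range m, C (((n + 2).factorial : ℂ)⁻¹) * X ^ n)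
      = NormedSpace.exp a - 1 := by
    rw [exp_eq_sum_of_pow_eq_zero hm2, Finset.sum_range_succ', Finset.sum_range_succ']
    have : ∀ n : ℕ, aeval a (X ^ 2 * (C (((n + 2).factorial : ℂ)⁻¹) * X ^ n))
        = (((n + 2).factorial : ℂ)⁻¹) • a ^ (n + 2) := fun n => by
      rw [mul_left_comm, ← pow_add, add_comm 2 n, map_mul, aeval_C, map_pow, aeval_X,
        Algebra.smul_def]
    rw [map_add, aeval_X, Finset.mul_sum, map_sum, Finset.sum_congr rfl fun n _ => this n]
    simp
    abel
  rw [this]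
  exact h.sub_left (Commute.one_left b)

/-- The exponential of a multiple of a nilpotent element grows polynomially. -/
theorem exists_norm_exp_smul_le {A : Type*} [NormedRing A] [NormedAlgebra ℂ A]
    {a : A} (ha : IsNilpotent a) :
    ∃ (C : ℝ) (m : ℕ), ∀ t : ℂ, ‖NormedSpace.exp (t • a)‖ ≤ C * (1 + ‖t‖) ^ m := by
  obtain ⟨m, hm⟩ := ha
  refine ⟨∑ n ∈ Finset.range m, ‖((n.factorial : ℂ)⁻¹)‖ * ‖a ^ n‖, m, fun t => ?_⟩
  rw [exp_eq_sum_of_pow_eq_zero (a := t • a) (m := m) (by rw [_root_.smul_pow, hm, smul_zero]),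
    Finset.sum_mul]
  refine (norm_sum_le _ _).trans (Finset.sum_le_sum fun n hn => ?_)
  rw [_root_.smul_pow, norm_smul, norm_smul, norm_pow]
  have h1 : ‖t‖ ^ n ≤ (1 + ‖t‖) ^ m :=
    (pow_le_pow_left₀ (norm_nonneg t) (by linarith) n).trans
      (pow_le_pow_right₀ (by linarith [norm_nonneg t]) (Finset.mem_range.1 hn).le)
  calc ‖((n.factorial : ℂ)⁻¹)‖ * (‖t‖ ^ n * ‖a ^ n‖)
      = ‖((n.factorial : ℂ)⁻¹)‖ * ‖a ^ n‖ * ‖t‖ ^ n := by ring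
    _ ≤ _ := by gcongr

theorem exp_neg_mul_exp {A : Type*} [NormedRing A] [NormedAlgebra ℂ A] [CompleteSpace A] (a : A) :
    NormedSpace.exp (-a) * NormedSpace.exp a = 1 := by
  let _ := NormedAlgebra.restrictScalars ℚ ℂ A
  rw [← NormedSpace.exp_add_of_commute (Commute.refl a).neg_left, neg_add_cancel,
    NormedSpace.exp_zero]

theorem exp_mul_exp_neg {A : Type*} [NormedRing A] [NormedAlgebra ℂ A] [CompleteSpace A] (a : A) :
    NormedSpace.exp a * NormedSpace.exp (-a) = 1 := by
  simpa using exp_neg_mul_exp (-a)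

end Exponential

/-! ### Holomorphic functions on polydiscs -/

section Polydisc

variable {A : Type*} [NormedAddCommGroup A] [NormedSpace ℂ A] {r : ℕ} {ρ : ℝ}

theorem isOpen_polydisc : IsOpen (polydisc r ρ) := by
  simp only [polydisc, Set.ofPred_forall]
  exact isOpen_iInter_of_finite fun j => isOpen_lt (by fun_prop) continuous_const

theorem update_mem_polydisc {s : Fin r → ℂ} (hs : s ∈ polydisc r ρ) (i : Fin r) {t : ℂ}
    (ht : ‖t‖ < ρ) : Function.update s i t ∈ polydisc r ρ := by
  intro j
  rcases eq_or_ne j i with rfl | h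
  · simpa using ht
  · simpa [h] using hs j

theorem differentiable_update (s : Fin r → ℂ) (i : Fin r) :
    Differentiable ℂ (fun t : ℂ => Function.update s i t) := by
  refine differentiable_pi.2 fun j => ?_
  rcases eq_or_ne j i with rfl | h
  · simp
  · simp [h]

theorem differentiable_update_const (i : Fin r) (t : ℂ) :
    Differentiable ℂ (fun s : Fin r → ℂ => Function.update s i t) := by
  refine differentiable_pi.2 fun j => ?_
  rcases eq_or_ne j i with rfl | h
  · simp
  · simp only [ne_eq, h, not_false_eq_true, Function.update_of_ne]; fun_prop

theorem differentiableOn_slice {f : (Fin r → ℂ) → A} (hf : DifferentiableOn ℂ f (polydisc r ρ))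
    {s : Fin r → ℂ} (hs : s ∈ polydisc r ρ) (i : Fin r) :
    DifferentiableOn ℂ (fun t => f (Function.update s i t)) (Metric.ball 0 ρ) :=
  hf.comp (differentiable_update s i).differentiableOn
    fun _ ht => update_mem_polydisc hs i (by simpa using ht)

/-- The Schwarz lemma in the `i`-th variable; `2 * B` bounds the difference of two values. -/
theorem norm_sub_update_zero_le {f : (Fin r → ℂ) → A}
    (hf : DifferentiableOn ℂ f (polydisc r ρ)) {B : ℝ} (hB : ∀ s ∈ polydisc r ρ, ‖f s‖ ≤ B)
    {s : Fin r → ℂ} (hs : s ∈ polydisc r ρ) (i : Fin r) {t : ℂ} (ht : ‖t‖ < ρ) :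
    ‖f (Function.update s i t) - f (Function.update s i 0)‖ ≤ 2 * B / ρ * ‖t‖ := by
  have hρ : 0 < ρ := (norm_nonneg t).trans_lt ht
  have h := Complex.dist_le_div_mul_dist_of_mapsTo_ball (differentiableOn_slice hf hs i)
    (R₂ := 2 * B) (z := t) (c := 0) ?_ (by simpa using ht)
  · simpa [dist_eq_norm] using h
  · intro w hw
    have h1 := hB _ (update_mem_polydisc hs i (t := w) (by simpa using hw))
    have h2 := hB _ (update_mem_polydisc hs i (t := 0) (by simpa using hρ))
    rw [Metric.mem_closedBall, dist_eq_norm]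
    exact (norm_sub_le _ _).trans (by linarith)

end Polydisc

/-! ### Growth of the adjoint action -/

section Adjoint

variable {E : Type*} [NormedAddCommGroup E] [NormedSpace ℂ E] {r : ℕ}

theorem adExp_add_right (X Y Z : E →L[ℂ] E) : adExp X (Y + Z) = adExp X Y + adExp X Z := by
  simp only [adExp, mul_add, add_mul]

theorem adExp_of_commute [CompleteSpace E] {X Y : E →L[ℂ] E} (h : Commute X Y) :
    adExp X Y = Y := by
  have : Commute (NormedSpace.exp X) Y := h.exp_left
  rw [adExp, this.eq, mul_assoc, exp_mul_exp_neg, mul_one]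

theorem adExp_add_of_commute [CompleteSpace E] {X Y : E →L[ℂ] E} (h : Commute X Y)
    (Z : E →L[ℂ] E) : adExp (X + Y) Z = adExp X (adExp Y Z) := by
  let _ := NormedAlgebra.restrictScalars ℚ ℂ (E →L[ℂ] E)
  have h1 : NormedSpace.exp (-(X + Y)) = NormedSpace.exp (-Y) * NormedSpace.exp (-X) := by
    rw [neg_add_rev]
    exact NormedSpace.exp_add_of_commute h.symm.neg_left.neg_right
  simp only [adExp]
  rw [h1, NormedSpace.exp_add_of_commute h]
  simp only [mul_assoc]

theorem exists_norm_adExp_smul_le {X : E →L[ℂ] E} (hX : IsNilpotent X) :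
    ∃ (C : ℝ) (m : ℕ), 0 ≤ C ∧ ∀ (t : ℂ) (Y : E →L[ℂ] E),
      ‖adExp (t • X) Y‖ ≤ C * (1 + ‖t‖) ^ m * ‖Y‖ := by
  obtain ⟨C, m, h⟩ := exists_norm_exp_smul_le hX
  refine ⟨C * C, m + m, mul_self_nonneg C, fun t Y => ?_⟩
  have h1 := h t
  have h2 := h (-t)
  rw [norm_neg, neg_smul] at h2
  calc ‖adExp (t • X) Y‖
      ≤ ‖NormedSpace.exp (t • X)‖ * ‖Y‖ * ‖NormedSpace.exp (-(t • X))‖ :=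
        (norm_mul_le _ _).trans (by gcongr; exact norm_mul_le _ _)
    _ ≤ (C * (1 + ‖t‖) ^ m) * ‖Y‖ * (C * (1 + ‖t‖) ^ m) := by
        gcongr
        exact mul_nonneg ((norm_nonneg _).trans h1) (norm_nonneg _)
    _ = _ := by rw [pow_add]; ring

/-- If a bounded holomorphic function commutes with `N j` along `s j = 0`, then conjugating it
by the exponentials of `z j • N j` costs at most a factor `1 + O(‖s j‖ (1 + ‖z j‖) ^ m)`. -/
theorem norm_adExp_sum_le [CompleteSpace E] {N : Fin r → E →L[ℂ] E}
    (hN : ∀ i j, Commute (N i) (N j)) {C : Fin r → ℝ} {m : Fin r → ℕ} (hC : ∀ j, 0 ≤ C j)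
    (had : ∀ j (t : ℂ) (Y : E →L[ℂ] E), ‖adExp (t • N j) Y‖ ≤ C j * (1 + ‖t‖) ^ m j * ‖Y‖)
    {ρ : ℝ} (K : Finset (Fin r)) {f : (Fin r → ℂ) → E →L[ℂ] E}
    (hf : DifferentiableOn ℂ f (polydisc r ρ)) {B : ℝ} (hB : ∀ s ∈ polydisc r ρ, ‖f s‖ ≤ B)
    (hcomm : ∀ j ∈ K, ∀ s ∈ polydisc r ρ, s j = 0 → Commute (N j) (f s))
    {s : Fin r → ℂ} (hs : s ∈ polydisc r ρ) (z : Fin r → ℂ) :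
    ‖adExp (∑ j ∈ K, z j • N j) (f s)‖
      ≤ B * ∏ j ∈ K, (1 + 2 * C j / ρ * (‖s j‖ * (1 + ‖z j‖) ^ m j)) := by
  induction K using Finset.induction_on generalizing f B with
  | empty => simpa [adExp] using hB s hs
  | insert i K hi ih =>
    have hρ : 0 < ρ := (norm_nonneg _).trans_lt (hs i)
    have h0 : ‖(0 : ℂ)‖ < ρ := by simpa using hρ
    have hdiff : ∀ t : ℂ, ‖t‖ < ρ →
        DifferentiableOn ℂ (fun s => f (Function.update s i t)) (polydisc r ρ) := fun t ht =>
      hf.comp (differentiable_update_const i t).differentiableOn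
        fun _ hs => update_mem_polydisc hs i ht
    have hc : ∀ t : ℂ, ‖t‖ < ρ → ∀ j ∈ K, ∀ s ∈ polydisc r ρ, s j = 0 →
        Commute (N j) (f (Function.update s i t)) := fun t ht j hj s hs hsj => by
      refine hcomm j (Finset.mem_insert_of_mem hj) _ (update_mem_polydisc hs i ht) ?_
      rw [Function.update_of_ne (by rintro rfl; exact hi hj), hsj]
    -- The induction hypothesis is used twice: for the restriction to `s i = 0`, with the same bound
    -- `B`, and for the remainder, where the Schwarz lemma improves the bound to `O(‖s i‖)`.
    have e1 := ih (f := fun s => f (Function.update s i 0)) (B := B) (hdiff 0 h0)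
      (fun s hs => hB _ (update_mem_polydisc hs i h0)) (hc 0 h0)
    have e2 := ih (f := fun s' => f (Function.update s' i (s i)) - f (Function.update s' i 0))
      (B := 2 * B / ρ * ‖s i‖) ((hdiff _ (hs i)).sub (hdiff 0 h0))
      (fun s' hs' => norm_sub_update_zero_le hf hB hs' i (hs i))
      (fun j hj s' hs' h => (hc _ (hs i) j hj s' hs' h).sub_right (hc 0 h0 j hj s' hs' h))
    simp only [Function.update_eq_self] at e2
    set P := ∏ j ∈ K, (1 + 2 * C j / ρ * (‖s j‖ * (1 + ‖z j‖) ^ m j))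
    have hcs : Commute (∑ j ∈ K, z j • N j) (z i • N i) :=
      Commute.sum_left _ _ _ fun j _ => ((hN j i).smul_left _).smul_right _
    have hfix : Commute (z i • N i) (f (Function.update s i 0)) :=
      (hcomm i (Finset.mem_insert_self i K) _ (update_mem_polydisc hs i h0)
        (Function.update_self i 0 s)).smul_left _
    -- Only the remainder feels `exp (z i • N i)`, since the restriction commutes with `N i`.
    have split : adExp (∑ j ∈ insert i K, z j • N j) (f s)
        = adExp (∑ j ∈ K, z j • N j) (f (Function.update s i 0))
          + adExp (z i • N i)
              (adExp (∑ j ∈ K, z j • N j) (f s - f (Function.update s i 0))) := by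
      rw [← adExp_add_of_commute hcs.symm, Finset.sum_insert hi]
      conv_lhs => rw [← add_sub_cancel (f (Function.update s i 0)) (f s), adExp_add_right]
      congr 1
      rw [add_comm, adExp_add_of_commute hcs, adExp_of_commute hfix]
    rw [split, Finset.prod_insert hi]
    have hCi := hC i
    calc _ ≤ B * P + C i * (1 + ‖z i‖) ^ m i * (2 * B / ρ * ‖s i‖ * P) :=
          (norm_add_le _ _).trans (add_le_add e1 ((had i _ _).trans (by gcongr)))
      _ = _ := by ring

end Adjoint

/-! ### Logarithmic growth of the branches and the limit -/

section Branch

variable {r : ℕ}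

/-- With `y = e / x`, the function becomes `(log y) ^ n / (e⁻¹ y)` as `y → ∞`. -/
theorem tendsto_norm_mul_one_add_abs_log_pow (n : ℕ) :
    Tendsto (fun x : ℝ => x * (1 + |Real.log x|) ^ n) (𝓝[>] 0) (𝓝 0) := by
  have h1 : Tendsto (fun x : ℝ => Real.exp 1 * x⁻¹) (𝓝[>] 0) atTop :=
    tendsto_inv_nhdsGT_zero.const_mul_atTop (Real.exp_pos 1)
  have h2 := (Real.tendsto_pow_log_div_mul_add_atTop (Real.exp (-1)) 0 n
    (Real.exp_pos _).ne').comp h1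
  refine h2.congr' ?_
  filter_upwards [Ioo_mem_nhdsGT one_pos] with x hx
  have hlog : Real.log x ≤ 0 := Real.log_nonpos hx.1.le hx.2.le
  simp only [Function.comp]
  rw [Real.log_mul (Real.exp_pos 1).ne' (inv_ne_zero hx.1.ne'), Real.log_exp, Real.log_inv,
    abs_of_nonpos hlog, ← mul_assoc, ← Real.exp_add]
  simp [mul_comm]

theorem polydisc_mem_nhds {ρ : ℝ} (hρ : 0 < ρ) : polydisc r ρ ∈ 𝓝 (0 : Fin r → ℂ) :=
  isOpen_polydisc.mem_nhds fun _ => by simpa using hρ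

theorem norm_cover (z : Fin r → ℂ) (j : Fin r) :
    ‖cover z j‖ = Real.exp (-(2 * Real.pi * (z j).im)) := by
  rw [cover, Complex.norm_exp]
  congr 1
  simp [mul_assoc]

theorem IsBranchChoice.tendsto_mul_pow {z : (Fin r → ℂ) → Fin r → ℂ} (hz : IsBranchChoice z)
    (j : Fin r) (m : ℕ) :
    Tendsto (fun s : Fin r → ℂ => ‖s j‖ * (1 + ‖z s j‖) ^ m) (𝓝[puncturedPolydisc r] 0)
      (𝓝 0) := by
  obtain ⟨hcov, C, k, hC⟩ := hz
  have hs : Tendsto (fun s : Fin r → ℂ => ‖s j‖) (𝓝[puncturedPolydisc r] 0) (𝓝[>] 0) := by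
    refine tendsto_nhdsWithin_iff.2 ⟨?_, ?_⟩
    · have : Continuous fun s : Fin r → ℂ => ‖s j‖ := by fun_prop
      simpa using (this.tendsto 0).mono_left nhdsWithin_le_nhds
    · filter_upwards [self_mem_nhdsWithin] with s hs
      exact norm_pos_iff.2 (hs j).1
  have hlim := ((tendsto_norm_mul_one_add_abs_log_pow ((k + 1) * m)).comp hs).const_mul
    ((2 + |C|) ^ m)
  rw [mul_zero] at hlim
  refine squeeze_zero' (Eventually.of_forall fun s => by positivity) ?_ hlim
  filter_upwards [hcov, hC] with s h1 h2
  set L := |Real.log ‖s j‖| with hL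
  have hL0 : 0 ≤ L := abs_nonneg _
  have him : |(z s j).im| ≤ L := by
    have : Real.log ‖s j‖ = -(2 * Real.pi * (z s j).im) := by
      conv_lhs => rw [← h1]
      rw [norm_cover, Real.log_exp]
    have h3 := Real.pi_gt_three
    rw [hL, this, abs_neg, abs_mul, abs_of_pos (a := 2 * Real.pi) (by linarith)]
    nlinarith [abs_nonneg (z s j).im]
  -- The exponent `k + 1` is positive even for `k = 0`, so that the same power also dominates `1 +
  -- L` and with it the imaginary part.
  have hre : |(z s j).re| ≤ |C| * (1 + L) ^ (k + 1) := by
    refine (h2 j).trans ?_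
    gcongr
    · exact le_abs_self C
    · linarith
    · omega
  have hone : 1 + L ≤ (1 + L) ^ (k + 1) := le_self_pow₀ (by linarith) (by omega)
  have hb : 1 + ‖z s j‖ ≤ (2 + |C|) * (1 + L) ^ (k + 1) := by
    have := Complex.norm_le_abs_re_add_abs_im (z s j)
    nlinarith [abs_nonneg C]
  calc ‖s j‖ * (1 + ‖z s j‖) ^ m ≤ ‖s j‖ * ((2 + |C|) * (1 + L) ^ (k + 1)) ^ m := by gcongr
    _ = _ := by simp only [Function.comp]; rw [mul_pow, ← pow_mul]; ring

/-- If `Γ` vanishes at the origin and commutes with `N j` along `s j = 0`, then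
`Ad (exp (∑ z j • N j)) Γ` tends to zero. -/
theorem tendsto_adExp_of_commute {E : Type*} [NormedAddCommGroup E] [NormedSpace ℂ E]
    [CompleteSpace E] {N : Fin r → E →L[ℂ] E} (hN : ∀ i j, Commute (N i) (N j))
    (hnil : ∀ j, IsNilpotent (N j)) {ρ : ℝ} (hρ : 0 < ρ) {f : (Fin r → ℂ) → E →L[ℂ] E}
    (hf : DifferentiableOn ℂ f (polydisc r ρ)) (hf0 : f 0 = 0)
    (hcomm : ∀ j, ∀ s ∈ polydisc r ρ, s j = 0 → Commute (N j) (f s))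
    {z : (Fin r → ℂ) → Fin r → ℂ} (hz : IsBranchChoice z) :
    Tendsto (fun s => adExp (monoSum N (z s)) (f s)) (𝓝[puncturedPolydisc r] 0) (𝓝 0) := by
  choose C m hC had using fun j => exists_norm_adExp_smul_le (hnil j)
  rw [Metric.tendsto_nhds]
  intro ε hε
  have hcont : ContinuousAt f 0 :=
    (hf.differentiableAt (polydisc_mem_nhds hρ)).continuousAt
  -- `ε / 2` leaves room for the product of correction factors, which tends to `1` and is eventually
  -- below `2`.
  obtain ⟨δ, hδ, hsmall⟩ := Metric.continuousAt_iff.1 hcont (ε / 2) (half_pos hε)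
  set ρ' := min ρ δ
  have hρ' : 0 < ρ' := lt_min hρ hδ
  have hsub : polydisc r ρ' ⊆ polydisc r ρ := fun s hs j => (hs j).trans_le (min_le_left _ _)
  have hB : ∀ s ∈ polydisc r ρ', ‖f s‖ ≤ ε / 2 := fun s hs => by
    have := hsmall (x := s) (by
      rw [dist_zero_right, pi_norm_lt_iff hδ]
      exact fun j => (hs j).trans_le (min_le_right _ _))
    rw [hf0, dist_zero_right] at this
    exact this.le
  have hprod : Tendsto
      (fun s => ∏ j, (1 + 2 * C j / ρ' * (‖s j‖ * (1 + ‖z s j‖) ^ m j)))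
      (𝓝[puncturedPolydisc r] 0) (𝓝 1) := by
    have := tendsto_finsetProd (Finset.univ : Finset (Fin r)) fun j _ =>
      ((hz.tendsto_mul_pow j (m j)).const_mul (2 * C j / ρ')).const_add 1
    simpa using this
  filter_upwards [hprod.eventually (gt_mem_nhds one_lt_two),
    nhdsWithin_le_nhds (polydisc_mem_nhds hρ')] with s h1 h2
  rw [dist_zero_right]
  refine (norm_adExp_sum_le hN hC had Finset.univ (hf.mono hsub) hB
    (fun j _ s hs => hcomm j s (hsub hs)) h2 (z s)).trans_lt ?_
  nlinarith

end Branch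

/-! ### Sums of independent subspaces -/

section Grading

variable {E ι : Type*} [AddCommGroup E] [Module ℂ E] {I : ι → Submodule ℂ E}

/-- The modular law isolates the part over `S \ T`, which independence makes disjoint from the sum
over `T`. -/
theorem biSup_inf_biSup (h : iSupIndep I) (S T : Set ι) :
    (⨆ i ∈ S, I i) ⊓ (⨆ i ∈ T, I i) = ⨆ i ∈ S ∩ T, I i := by
  have h1 : (⨆ i ∈ S, I i) = (⨆ i ∈ S ∩ T, I i) ⊔ ⨆ i ∈ S \ T, I i := by
    rw [← iSup_union, Set.inter_union_sdiff]
  have h2 : (⨆ i ∈ S ∩ T, I i) ≤ ⨆ i ∈ T, I i := biSup_mono fun _ hi => hi.2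
  have h3 : Disjoint (⨆ i ∈ S \ T, I i) (⨆ i ∈ T, I i) :=
    h.disjoint_biSup_biSup Set.disjoint_sdiff_left
  rw [h1, sup_inf_assoc_of_le _ h2, h3.eq_bot, sup_bot_eq]

end Grading

/-! ### The Deligne bigrading and its opposite filtration -/

section Bigrading

variable {E : Type*} [NormedAddCommGroup E] [NormedSpace ℂ E]

/-- The sum of the pieces `I a b` of a bigrading with `(a, b)` in a given set. -/
def pieceSum (I : ℤ → ℤ → Submodule ℂ E) (S : Set (ℤ × ℤ)) : Submodule ℂ E :=
  ⨆ i ∈ S, I i.1 i.2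

theorem pieceSum_le {I : ℤ → ℤ → Submodule ℂ E} {S : Set (ℤ × ℤ)} {A : Submodule ℂ E} :
    pieceSum I S ≤ A ↔ ∀ a b, (a, b) ∈ S → I a b ≤ A := by
  simp [pieceSum]

theorem le_pieceSum {I : ℤ → ℤ → Submodule ℂ E} {S : Set (ℤ × ℤ)} {a b : ℤ}
    (h : (a, b) ∈ S) : I a b ≤ pieceSum I S :=
  pieceSum_le.1 le_rfl a b h

theorem pieceSum_mono {I : ℤ → ℤ → Submodule ℂ E} {S T : Set (ℤ × ℤ)} (h : S ⊆ T) :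
    pieceSum I S ≤ pieceSum I T :=
  biSup_mono h

theorem iSup_piece_eq (I : ℤ → ℤ → Submodule ℂ E) (P : ℤ → ℤ → Prop) :
    (⨆ (a : ℤ) (b : ℤ) (_ : P a b), I a b) = pieceSum I {i | P i.1 i.2} := by
  simp only [pieceSum, Set.mem_ofPred_eq, iSup_prod]

/-- The increasing filtration opposite to the Hodge filtration of a bigrading. -/
def opposite (I : ℤ → ℤ → Submodule ℂ E) (p : ℤ) : Submodule ℂ E := pieceSum I {i | i.1 ≤ p}

variable {D : PolarizedData E} {F M : ℤ → Submodule ℂ E} {I : ℤ → ℤ → Submodule ℂ E}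

namespace IsDeligneBigrading

theorem pieceSum_inf (hI : IsDeligneBigrading D F M I) (S T : Set (ℤ × ℤ)) :
    pieceSum I S ⊓ pieceSum I T = pieceSum I (S ∩ T) :=
  biSup_inf_biSup hI.internal.submodule_iSupIndep S T

theorem pieceSum_univ (hI : IsDeligneBigrading D F M I) : pieceSum I Set.univ = ⊤ := by
  simpa [pieceSum] using hI.internal.submodule_iSup_eq_top

theorem hodge_eq (hI : IsDeligneBigrading D F M I) (p : ℤ) :
    F p = pieceSum I {i | p ≤ i.1} := by
  rw [hI.hodge, iSup_piece_eq]

theorem weight_eq (hI : IsDeligneBigrading D F M I) (k : ℤ) :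
    M k = pieceSum I {i | i.1 + i.2 ≤ k} := by
  rw [hI.weight, iSup_piece_eq]

theorem hodge_inf_opposite (hI : IsDeligneBigrading D F M I) {p q : ℤ} (h : q < p) :
    F p ⊓ opposite I q = ⊥ := by
  rw [hI.hodge_eq, opposite, hI.pieceSum_inf, eq_bot_iff, pieceSum_le]
  rintro a b ⟨h1, h2⟩
  simp only [Set.mem_ofPred_eq] at h1 h2
  omega

theorem opposite_eq_bot (hI : IsDeligneBigrading D F M I) (hF : ∃ p, F p = ⊤) :
    ∃ p, opposite I p = ⊥ := by
  obtain ⟨p, hp⟩ := hF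
  have := hI.hodge_inf_opposite (sub_one_lt p)
  rw [hp, top_inf_eq] at this
  exact ⟨_, this⟩

theorem opposite_eq_top (hI : IsDeligneBigrading D F M I) (hF : ∃ p, F p = ⊥) :
    ∃ p, opposite I p = ⊤ := by
  obtain ⟨p, hp⟩ := hF
  refine ⟨p, ?_⟩
  rw [eq_top_iff, ← hI.pieceSum_univ, pieceSum_le]
  intro a b _
  rcases le_total a p with h | h
  · exact le_pieceSum h
  · refine le_trans ?_ bot_le
    rw [← hp, hI.hodge_eq]
    exact le_pieceSum h

/-- The piece `I a b` and its conjugate. -/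
theorem conj_mem (hI : IsDeligneBigrading D F M I) {a b : ℤ} {v : E} (hv : v ∈ I a b) :
    D.conj v ∈ pieceSum I ({(b, a)} ∪ {i | i.1 < b ∧ i.2 < a}) := by
  have h1 : D.conj v ∈ D.conjSub (I a b) := by
    simpa [PolarizedData.conjSub, D.conj_conj] using hv
  have h2 := (hI.conj b a).ge (Submodule.mem_sup_left h1)
  rw [iSup_piece_eq] at h2
  exact (sup_le (le_pieceSum (Or.inl rfl)) (pieceSum_mono Set.subset_union_right) :
    _ ≤ pieceSum I ({(b, a)} ∪ {i | i.1 < b ∧ i.2 < a})) h2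

theorem conj_mem_of_mem_pieceSum (hI : IsDeligneBigrading D F M I) {S T : Set (ℤ × ℤ)}
    (h : ∀ a b, (a, b) ∈ S → {(b, a)} ∪ {i | i.1 < b ∧ i.2 < a} ⊆ T) {v : E}
    (hv : v ∈ pieceSum I S) : D.conj v ∈ pieceSum I T := by
  have : pieceSum I S ≤ D.conjSub (pieceSum I T) :=
    pieceSum_le.2 fun a b hab w hw => pieceSum_mono (h a b hab) (hI.conj_mem hw)
  exact this hv

/-- A real endomorphism which shifts the Hodge filtration by `-1` and the weight filtration by
`-2` also shifts the opposite filtration by `-1`. -/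
theorem map_opposite (hI : IsDeligneBigrading D F M I) {N : E →L[ℂ] E}
    (hreal : ∀ v, N (D.conj v) = D.conj (N v)) (hF : ∀ p, ∀ v ∈ F p, N v ∈ F (p - 1))
    (hM : ∀ k, ∀ v ∈ M k, N v ∈ M (k - 2)) (p : ℤ) {v : E} (hv : v ∈ opposite I p) :
    N v ∈ opposite I (p - 1) := by
  -- Conjugation carries `opposite` into the filtration by the second index, and back. On `I a b`
  -- the image under `N` has indices `(c, d)` with `c ≥ a - 1` and `c + d ≤ a + b - 2`, whence `d ≤
  -- b - 1`.
  have step : ∀ q : ℤ, pieceSum I {i | i.2 ≤ q} ≤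
      (pieceSum I {i | i.2 ≤ q - 1}).comap (N : E →ₗ[ℂ] E) := fun q => by
    refine pieceSum_le.2 fun a b hab w hw => ?_
    have h1 : N w ∈ F (a - 1) := hF a w (by rw [hI.hodge_eq]; exact le_pieceSum (by simp) hw)
    have h2 : N w ∈ M (a + b - 2) :=
      hM _ w (by rw [hI.weight_eq]; exact le_pieceSum (by simp) hw)
    rw [hI.hodge_eq] at h1
    rw [hI.weight_eq] at h2
    have h3 := (hI.pieceSum_inf _ _).le (Submodule.mem_inf.2 ⟨h1, h2⟩)
    refine pieceSum_mono ?_ h3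
    rintro ⟨c, d⟩ ⟨h4, h5⟩
    simp only [Set.mem_ofPred_eq] at *
    omega
  have h1 : D.conj v ∈ pieceSum I {i | i.2 ≤ p} := by
    refine hI.conj_mem_of_mem_pieceSum ?_ hv
    rintro a b hab ⟨c, d⟩ h
    simp at h hab ⊢
    omega
  have h2 : D.conj (N (D.conj v)) ∈ opposite I (p - 1) := by
    refine hI.conj_mem_of_mem_pieceSum ?_ (step p h1)
    rintro a b hab ⟨c, d⟩ h
    simp at h hab ⊢
    omega
  rwa [hreal, D.conj_conj] at h2

/-- An endomorphism vanishes if it shifts the Hodge filtration by at most one step down, and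
the opposite filtration by at least two steps down. -/
theorem eq_zero_of_shift (hI : IsDeligneBigrading D F M I) {T : E →L[ℂ] E}
    (hF : ∀ p, ∀ v ∈ F p, T v ∈ F (p - 1))
    (hop : ∀ p, ∀ v ∈ opposite I p, T v ∈ opposite I (p - 2)) : T = 0 := by
  have : pieceSum I Set.univ ≤ LinearMap.ker (T : E →ₗ[ℂ] E) := by
    refine pieceSum_le.2 fun a b _ w hw => ?_
    have h1 := hF a w (by rw [hI.hodge_eq]; exact le_pieceSum (by simp) hw)
    have h2 := hop a w (le_pieceSum (by simp) hw)
    have h3 : T w ∈ F (a - 1) ⊓ opposite I (a - 2) := ⟨h1, h2⟩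
    rwa [hI.hodge_inf_opposite (by omega), Submodule.mem_bot] at h3
  ext v
  exact this (by rw [hI.pieceSum_univ]; trivial)

end IsDeligneBigrading

theorem map_opposite_of_mem_qSub {X : E →L[ℂ] E} (hX : X ∈ qSub D I) (p : ℤ) {v : E}
    (hv : v ∈ opposite I p) : X v ∈ opposite I (p - 1) := by
  -- The endomorphisms with the required shift form a subspace, so it suffices to test the pieces
  -- spanning `qSub`.
  let A : Submodule ℂ (E →L[ℂ] E) :=
    ⨅ v : opposite I p, (opposite I (p - 1)).comap
      ((ContinuousLinearMap.apply ℂ E (v : E)) : (E →L[ℂ] E) →ₗ[ℂ] E)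
  have hA : qSub D I ≤ A := by
    refine iSup_le fun a => iSup_le fun b => iSup_le fun ha Y hY => ?_
    rw [Submodule.mem_iInf]
    rintro ⟨w, hw⟩
    have : opposite I p ≤ (opposite I (p - 1)).comap (Y : E →ₗ[ℂ] E) :=
      pieceSum_le.2 fun c d hcd u hu => le_pieceSum (by simp at hcd ⊢; omega) (hY.2 c d u hu)
    exact this hw
  exact (Submodule.mem_iInf _).1 (hA hX) ⟨v, hv⟩

theorem pow_map_opposite {X : E →L[ℂ] E}
    (hX : ∀ p, ∀ v ∈ opposite I p, X v ∈ opposite I (p - 1)) (n : ℕ) (p : ℤ) {v : E}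
    (hv : v ∈ opposite I p) : (X ^ n) v ∈ opposite I (p - n) := by
  induction n with
  | zero => simpa using hv
  | succ n ih =>
    rw [pow_succ', mul_apply_eq_comp]
    have := hX _ _ ih
    rwa [show p - ((n + 1 : ℕ) : ℤ) = p - n - 1 by push_cast; ring]

theorem opposite_mono : Monotone (opposite I) := fun _ _ h =>
  pieceSum_mono fun _ hi => le_trans hi h

theorem isNilpotent_of_map_opposite {X : E →L[ℂ] E} (htop : ∃ p, opposite I p = ⊤)
    (hbot : ∃ p, opposite I p = ⊥)
    (hX : ∀ p, ∀ v ∈ opposite I p, X v ∈ opposite I (p - 1)) : IsNilpotent X := by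
  obtain ⟨p, hp⟩ := htop
  obtain ⟨q, hq⟩ := hbot
  refine ⟨(p - q).toNat, ?_⟩
  ext v
  have h1 := pow_map_opposite hX (p - q).toNat p (v := v) (by rw [hp]; trivial)
  have h2 := opposite_mono (I := I) (show p - ((p - q).toNat : ℤ) ≤ q by omega) h1
  rwa [hq, Submodule.mem_bot] at h2

/-- For `X` lowering the opposite filtration, so does `exp X - 1`. -/
theorem exp_sub_one_map_opposite {X : E →L[ℂ] E} (hnil : IsNilpotent X)
    (hX : ∀ p, ∀ v ∈ opposite I p, X v ∈ opposite I (p - 1)) (p : ℤ) {v : E}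
    (hv : v ∈ opposite I p) : NormedSpace.exp X v - v ∈ opposite I (p - 1) := by
  obtain ⟨m, hm⟩ := hnil
  rw [exp_eq_sum_of_pow_eq_zero (m := m + 1) (pow_eq_zero_of_le (by omega) hm),
    Finset.sum_range_succ', add_apply, sum_apply]
  simp only [Nat.factorial_zero, pow_zero, Nat.cast_one, inv_one, one_smul,
    one_apply_eq_self, add_sub_cancel_right]
  refine Submodule.sum_mem _ fun n _ => ?_
  exact Submodule.smul_mem _ _
    (opposite_mono (by push_cast; omega) (pow_map_opposite hX (n + 1) p hv))

/-- If `exp (-X) N exp X` shifts the Hodge filtration by `-1`, where `N` shifts both filtrations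
by `-1` and `X` lowers the opposite filtration, then `N` and `X` commute. -/
theorem IsDeligneBigrading.commute_of_conj_shift [CompleteSpace E]
    (hI : IsDeligneBigrading D F M I) (htop : ∃ p, F p = ⊤) (hbot : ∃ p, F p = ⊥)
    {N X : E →L[ℂ] E} (hX : ∀ p, ∀ v ∈ opposite I p, X v ∈ opposite I (p - 1))
    (hNF : ∀ p, ∀ v ∈ F p, N v ∈ F (p - 1))
    (hN : ∀ p, ∀ v ∈ opposite I p, N v ∈ opposite I (p - 1))
    (hXN : ∀ p, ∀ v ∈ F p,
      (NormedSpace.exp (-X) * N * NormedSpace.exp X) v ∈ F (p - 1)) : Commute N X := by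
  have hnil := isNilpotent_of_map_opposite (hI.opposite_eq_top hbot) (hI.opposite_eq_bot htop) hX
  have hexp : ∀ p, ∀ v ∈ opposite I p, NormedSpace.exp (-X) v ∈ opposite I p :=
    fun p v hv => by
      have := exp_sub_one_map_opposite hnil.neg
        (fun p v hv => by simpa using hX p v hv) p hv
      have := add_mem (opposite_mono (sub_one_lt p).le this) hv
      rwa [sub_add_cancel] at this
  have hT : NormedSpace.exp (-X) * N * NormedSpace.exp X - N = 0 := by
    refine hI.eq_zero_of_shift (fun p v hv => sub_mem (hXN p v hv) (hNF p v hv))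
      fun p v hv => ?_
    -- The difference equals `exp (-X) (N (exp X - 1) - (exp X - 1) N)`; each product lowers
    -- `opposite` twice, and `exp (-X)` preserves it.
    have h1 := hN _ _ (exp_sub_one_map_opposite hnil hX p hv)
    have h2 := exp_sub_one_map_opposite hnil hX _ (hN p v hv)
    have h3 := hexp _ _ (sub_mem h1 h2)
    rw [show p - 1 - 1 = p - 2 by ring] at h3
    have h4 : NormedSpace.exp (-X) (NormedSpace.exp X (N v)) = N v :=
      congrArg (fun g : E →L[ℂ] E => g (N v)) (exp_neg_mul_exp X)
    simpa [h4] using h3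
  have hcomm : N * NormedSpace.exp X = NormedSpace.exp X * N := by
    rw [sub_eq_zero] at hT
    nth_rw 2 [← hT]
    rw [← mul_assoc, ← mul_assoc, exp_mul_exp_neg, one_mul]
  exact (commute_of_commute_exp hnil hcomm.symm).symm

end Bigrading

/-! ### The covering by the product of upper half-planes -/

variable {E : Type*} [NormedAddCommGroup E] [NormedSpace ℂ E] {r : ℕ}

theorem monoSum_add_single (N : Fin r → E →L[ℂ] E) (z : Fin r → ℂ) (j : Fin r) (t : ℂ) :
    monoSum N (z + Pi.single j t) = monoSum N z + t • N j := by
  simp only [monoSum, Pi.add_apply, add_smul, Finset.sum_add_distrib]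
  congr 1
  rw [Finset.sum_eq_single j] <;> simp +contextual

theorem commute_monoSum {N : Fin r → E →L[ℂ] E} (hN : ∀ i j, Commute (N i) (N j))
    (z : Fin r → ℂ) (j : Fin r) : Commute (monoSum N z) (N j) :=
  Commute.sum_left _ _ _ fun i _ => (hN i j).smul_left _

theorem cover_add_single (z : Fin r → ℂ) (j : Fin r) (t : ℂ) :
    cover (z + Pi.single j t)
      = Function.update (cover z) j (cover z j * Complex.exp (2 * Real.pi * Complex.I * t)) := by
  ext i
  rcases eq_or_ne i j with rfl | h
  · simp [cover, mul_add, Complex.exp_add]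
  · simp [cover, h]

theorem differentiable_cover : Differentiable ℂ (cover : (Fin r → ℂ) → Fin r → ℂ) := by
  unfold cover
  fun_prop

theorem isOpen_upperHalf : IsOpen (upperHalf r) := by
  simp only [upperHalf, Set.ofPred_forall]
  exact isOpen_iInter_of_finite fun j => isOpen_lt continuous_const (by fun_prop)

theorem exists_cover_eq {s : Fin r → ℂ} (hs : s ∈ puncturedPolydisc r) :
    ∃ z ∈ upperHalf r, cover z = s := by
  have h0 : (2 * Real.pi * Complex.I : ℂ) ≠ 0 := by simp [Real.pi_ne_zero]
  have key : cover (fun j => Complex.log (s j) / (2 * Real.pi * Complex.I)) = s := by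
    ext j
    rw [cover, mul_div_cancel₀ _ h0, Complex.exp_log (hs j).1]
  refine ⟨_, fun j => ?_, key⟩
  have h1 := (hs j).2
  rw [← key, norm_cover, Real.exp_lt_one_iff, neg_lt_zero] at h1
  exact pos_of_mul_pos_right h1 (by positivity)

theorem differentiable_exp_clm [CompleteSpace E] :
    Differentiable ℂ (NormedSpace.exp : (E →L[ℂ] E) → E →L[ℂ] E) := fun x =>
  (NormedSpace.exp_analytic (𝕂 := ℂ) x).differentiableAt

/-! ### Horizontality of the normal form and its residues -/

section Horizontality

variable [FiniteDimensional ℂ E] {D : PolarizedData E} {𝒱 : Variation D r}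
  {Finf : ℤ → Submodule ℂ E} {Γ : (Fin r → ℂ) → E →L[ℂ] E} {ρ : ℝ}

theorem differentiableOn_exp_slice (hd : DifferentiableOn ℂ Γ (polydisc r ρ))
    {s : Fin r → ℂ} (hs : s ∈ polydisc r ρ) (j : Fin r) :
    DifferentiableOn ℂ (fun τ => NormedSpace.exp (Γ (Function.update s j τ)))
      (Metric.ball 0 ρ) := by
  have := FiniteDimensional.complete ℂ E
  exact differentiable_exp_clm.comp_differentiableOn (differentiableOn_slice hd hs j)

/-- Griffiths horizontality in terms of the local normal form, off the divisor `∏ s j = 0`. -/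
theorem horizontal_of_localNormalForm (hd : DifferentiableOn ℂ Γ (polydisc r ρ))
    (hF : ∀ z ∈ upperHalf r, cover z ∈ polydisc r ρ → ∀ p, 𝒱.F z p =
      act (NormedSpace.exp (monoSum 𝒱.N z) * NormedSpace.exp (Γ (cover z))) (Finf p))
    {s : Fin r → ℂ} (hs : s ∈ puncturedPolydisc r) (hsρ : s ∈ polydisc r ρ) (j : Fin r)
    (p : ℤ) {u : E} (hu : u ∈ Finf p) :
    (NormedSpace.exp (-Γ s) * (𝒱.N j * NormedSpace.exp (Γ s) + (2 * Real.pi * Complex.I * s j) •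
      deriv (fun τ => NormedSpace.exp (Γ (Function.update s j τ))) (s j))) u
      ∈ Finf (p - 1) := by
  have := FiniteDimensional.complete ℂ E
  let _ := NormedAlgebra.restrictScalars ℚ ℂ (E →L[ℂ] E)
  obtain ⟨z, hz, rfl⟩ := exists_cover_eq hs
  -- The normal form carries the fixed vector `u` to a holomorphic section of `F^p`, whose
  -- derivative along the `j`-th coordinate is computed below.
  set v : (Fin r → ℂ) → E := fun w =>
    (NormedSpace.exp (monoSum 𝒱.N w) * NormedSpace.exp (Γ (cover w))) u with hv
  set O' := upperHalf r ∩ cover ⁻¹' polydisc r ρ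
  have hO' : IsOpen O' :=
    isOpen_upperHalf.inter (isOpen_polydisc.preimage differentiable_cover.continuous)
  have hzO : z ∈ O' := ⟨hz, hsρ⟩
  have hmono : Differentiable ℂ (monoSum 𝒱.N) := by unfold monoSum; fun_prop
  have hvd : DifferentiableOn ℂ v O' := by
    have h1 : DifferentiableOn ℂ (fun w => NormedSpace.exp (Γ (cover w))) O' :=
      differentiable_exp_clm.comp_differentiableOn
        (hd.comp differentiable_cover.differentiableOn fun w hw => hw.2)
    have h2 : DifferentiableOn ℂ (fun w => NormedSpace.exp (monoSum 𝒱.N w)) O' :=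
      (differentiable_exp_clm.comp hmono).differentiableOn
    exact (h2.mul h1).clm_apply (differentiableOn_const u)
  have hhor := 𝒱.F_horiz p O' hO' Set.inter_subset_left v hvd
    (fun w hw => by rw [hF w hw.1 hw.2]; exact Submodule.mem_map_of_mem hu) z hzO j
  set g : ℂ → E →L[ℂ] E := fun τ => NormedSpace.exp (Γ (Function.update (cover z) j τ)) with hg
  have hline : HasDerivAt (fun t : ℂ => v (z + Pi.single j t))
      (fderiv ℂ v z (Pi.single j 1)) 0 := by
    have h1 : HasFDerivAt v (fderiv ℂ v z) (z + Pi.single j (0 : ℂ)) := by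
      simpa using (hvd.differentiableAt (hO'.mem_nhds hzO)).hasFDerivAt
    have h2 : HasDerivAt (fun t : ℂ => z + Pi.single j t) (Pi.single j (1 : ℂ)) 0 :=
      (hasDerivAt_single j (0 : ℂ)).const_add z
    exact h1.comp_hasDerivAt 0 h2
  have hprod : HasDerivAt (fun t : ℂ => v (z + Pi.single j t))
      (NormedSpace.exp (monoSum 𝒱.N z) ((𝒱.N j * NormedSpace.exp (Γ (cover z))
        + (2 * Real.pi * Complex.I * cover z j) • deriv g (cover z j)) u)) 0 := by
    have hN : HasDerivAt (fun t : ℂ => NormedSpace.exp (t • 𝒱.N j)) (𝒱.N j) 0 := by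
      simpa using hasDerivAt_exp_smul_const (𝒱.N j) (0 : ℂ)
    -- Translating `z j` by `t` multiplies `s j` by `exp (2πi t)`; this produces the factor `2πi
    -- s_j` in front of the derivative.
    have hτ : HasDerivAt
        (fun t : ℂ => cover z j * Complex.exp (2 * Real.pi * Complex.I * t))
        (2 * Real.pi * Complex.I * cover z j) 0 := by
      have := (((hasDerivAt_id (0 : ℂ)).const_mul (2 * Real.pi * Complex.I)).cexp).const_mul
        (cover z j)
      simpa [mul_comm] using this
    have hgd : HasDerivAt g (deriv g (cover z j))
        (cover z j * Complex.exp (2 * Real.pi * Complex.I * 0)) := by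
      simp only [mul_zero, Complex.exp_zero, mul_one]
      exact ((differentiableOn_exp_slice hd hsρ j).differentiableAt
        (Metric.isOpen_ball.mem_nhds (by simpa using hsρ j))).hasDerivAt
    have hcomp := hgd.scomp (0 : ℂ) hτ
    have hall := ((hN.mul hcomp).const_mul (NormedSpace.exp (monoSum 𝒱.N z))).clm_apply
      (hasDerivAt_const (0 : ℂ) u)
    refine (hall.congr_deriv ?_).congr_of_eventuallyEq (Eventually.of_forall fun t => ?_)
    · simp [hg]
    · simp only [hv, hg]
      rw [monoSum_add_single, cover_add_single, NormedSpace.exp_add_of_commute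
        ((commute_monoSum 𝒱.N_comm z j).smul_right t), mul_assoc]
      rfl
  rw [hline.unique hprod, hF z hz hsρ] at hhor
  obtain ⟨u', hu', heq⟩ := hhor
  have h1 : NormedSpace.exp (Γ (cover z)) u' = (𝒱.N j * NormedSpace.exp (Γ (cover z))
        + (2 * Real.pi * Complex.I * cover z j) • deriv g (cover z j)) u := by
    have h2 := congrArg (fun x : E => (NormedSpace.exp (-monoSum 𝒱.N z) : E →L[ℂ] E) x) heq
    have h3 : ∀ x, NormedSpace.exp (-monoSum 𝒱.N z) (NormedSpace.exp (monoSum 𝒱.N z) x) = x :=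
      fun x => congrArg (fun g : E →L[ℂ] E => g x) (exp_neg_mul_exp (monoSum 𝒱.N z))
    rw [h3] at h2
    rw [← h2]
    exact (h3 _).symm
  rw [mul_apply_eq_comp, ← h1]
  have h4 : NormedSpace.exp (-Γ (cover z)) (NormedSpace.exp (Γ (cover z)) u') = u' :=
    congrArg (fun g : E →L[ℂ] E => g u') (exp_neg_mul_exp (Γ (cover z)))
  rwa [h4]

/-- The residue of the local normal form along `s j = 0` is horizontal. -/
theorem residue_horizontal (hρ : ρ ≤ 1) (hd : DifferentiableOn ℂ Γ (polydisc r ρ))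
    (hF : ∀ z ∈ upperHalf r, cover z ∈ polydisc r ρ → ∀ p, 𝒱.F z p =
      act (NormedSpace.exp (monoSum 𝒱.N z) * NormedSpace.exp (Γ (cover z))) (Finf p))
    {s : Fin r → ℂ} (hs : s ∈ polydisc r ρ) {j : Fin r} (hsj : s j = 0)
    (p : ℤ) {u : E} (hu : u ∈ Finf p) :
    (NormedSpace.exp (-Γ s) * 𝒱.N j * NormedSpace.exp (Γ s)) u ∈ Finf (p - 1) := by
  have := FiniteDimensional.complete ℂ E
  let _ := NormedAlgebra.restrictScalars ℚ ℂ (E →L[ℂ] E)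
  have hclosed : IsClosed (Finf (p - 1) : Set E) := (Finf (p - 1)).closed_of_finiteDimensional
  have hρ0 : 0 < ρ := (norm_nonneg _).trans_lt (hs j)
  have hexp : Continuous (NormedSpace.exp : (E →L[ℂ] E) → E →L[ℂ] E) :=
    differentiable_exp_clm.continuous
  -- At a point where only `s j` vanishes, moving `s j` to `τ ≠ 0` leaves the divisor. As `τ → 0`
  -- the derivative term dies, and membership survives because `Finf (p - 1)` is closed.
  have generic : ∀ s ∈ polydisc r ρ, s j = 0 → (∀ i, i ≠ j → s i ≠ 0) →
      (NormedSpace.exp (-Γ s) * 𝒱.N j * NormedSpace.exp (Γ s)) u ∈ Finf (p - 1) := by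
    intro s hs hsj hne
    set g : ℂ → E →L[ℂ] E := fun τ => NormedSpace.exp (Γ (Function.update s j τ)) with hg
    have h0 : Metric.ball (0 : ℂ) ρ ∈ 𝓝 (0 : ℂ) := Metric.ball_mem_nhds _ hρ0
    have hslice : ContinuousAt (fun τ => Γ (Function.update s j τ)) 0 :=
      ((differentiableOn_slice hd hs j).differentiableAt h0).continuousAt
    have hgc : ContinuousAt g 0 := hexp.continuousAt.comp hslice
    have hgd : ContinuousAt (deriv g) 0 :=
      (((differentiableOn_exp_slice hd hs j).deriv Metric.isOpen_ball).differentiableAt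
        h0).continuousAt
    have hneg : ContinuousAt (fun τ => NormedSpace.exp (-Γ (Function.update s j τ))) 0 :=
      hexp.continuousAt.comp hslice.neg
    have hcont : ContinuousAt (fun τ : ℂ => (NormedSpace.exp (-Γ (Function.update s j τ)) *
        (𝒱.N j * g τ + (2 * Real.pi * Complex.I * τ) • deriv g τ)) u) 0 := by
      refine ContinuousAt.clm_apply (hneg.mul ((continuousAt_const.mul hgc).add
        (ContinuousAt.smul (continuous_const.mul continuous_id).continuousAt hgd))) continuousAt_const
    have hlim := hcont.tendsto.mono_left (nhdsWithin_le_nhds (s := {0}ᶜ))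
    have hself : Function.update s j 0 = s := by rw [← hsj, Function.update_eq_self]
    have hmem := hclosed.mem_of_tendsto hlim (by
      filter_upwards [self_mem_nhdsWithin, nhdsWithin_le_nhds h0] with τ hτ hτρ
      have hτρ' : ‖τ‖ < ρ := by simpa using hτρ
      have hpoly := update_mem_polydisc hs j hτρ'
      have := horizontal_of_localNormalForm hd hF (s := Function.update s j τ)
        (fun i => ⟨?_, (hpoly i).trans_le hρ⟩) hpoly j p hu
      · simpa using this
      · rcases eq_or_ne i j with rfl | h
        · simpa using hτ
        · simpa [h] using hne i h)
    simpa [hg, hself, mul_assoc] using hmem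
  -- approximate `s` along the diagonal direction of `s j = 0`
  let c : ℂ → Fin r → ℂ := fun t => Function.update (fun i => s i + t) j 0
  have hc : Continuous c := (by fun_prop : Continuous fun t : ℂ => fun i => s i + t).update j
    continuous_const
  have hc0 : c 0 = s := by
    ext i
    rcases eq_or_ne i j with rfl | h
    · simp [c, hsj]
    · simp [c, h]
  have hΓ : ContinuousAt (fun t => Γ (c t)) 0 := by
    refine ContinuousAt.comp (f := c) (g := Γ) ?_ hc.continuousAt
    rw [hc0]
    exact (hd.differentiableAt (isOpen_polydisc.mem_nhds hs)).continuousAt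
  have hcont : ContinuousAt (fun t : ℂ =>
      (NormedSpace.exp (-Γ (c t)) * 𝒱.N j * NormedSpace.exp (Γ (c t))) u) 0 :=
    ContinuousAt.clm_apply (((hexp.continuousAt.comp hΓ.neg).mul continuousAt_const).mul
      (hexp.continuousAt.comp hΓ)) continuousAt_const
  have hlim := hcont.tendsto.mono_left (nhdsWithin_le_nhds (s := {0}ᶜ))
  rw [hc0] at hlim
  refine hclosed.mem_of_tendsto hlim ?_
  have hne : ∀ᶠ t in 𝓝[≠] (0 : ℂ), ∀ i, s i + t ≠ 0 := by
    rw [eventually_all]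
    intro i
    rcases eq_or_ne (s i) 0 with h | h
    · filter_upwards [self_mem_nhdsWithin] with t ht
      simpa [h] using ht
    · refine nhdsWithin_le_nhds (ContinuousAt.eventually_ne (by fun_prop) ?_)
      simpa using h
  filter_upwards [hne, nhdsWithin_le_nhds (hc.continuousAt.preimage_mem_nhds
    (isOpen_polydisc.mem_nhds (by rwa [hc0])))] with t h1 h2
  exact generic (c t) h2 (by simp [c]) fun i hi => by simpa [c, hi] using h1 i

end Horizontality

/-! ### Consequences of admissibility and conclusion -/

/-- Each `N j` shifts the monodromy weight filtration by `-2`. -/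
theorem Variation.IsAdmissible.shift_weight {D : PolarizedData E} {𝒱 : Variation D r}
    {Finf M : ℤ → Submodule ℂ E} (h : 𝒱.IsAdmissible Finf M) (j : Fin r) (k : ℤ) {v : E}
    (hv : v ∈ M k) : 𝒱.N j v ∈ M (k - 2) := by
  -- `N j` itself may lie outside the open cone, but it is the difference of the two cone elements
  -- `∑ N i + N j` and `∑ N i`.
  have h1 := (h.rel_cone (fun _ => 1) fun _ => one_pos).shift k v hv
  have h2 := (h.rel_cone (fun i => 1 + Pi.single (M := fun _ => ℝ) j 1 i) fun i => by
    have : (0 : ℝ) ≤ Pi.single (M := fun _ => ℝ) j 1 i := by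
      rw [Pi.single_apply]; split_ifs <;> simp
    linarith).shift k v hv
  have h3 : monoSum 𝒱.N (fun i => ((1 + Pi.single (M := fun _ => ℝ) j 1 i : ℝ) : ℂ))
      = monoSum 𝒱.N (fun _ => ((1 : ℝ) : ℂ)) + 𝒱.N j := by
    have := monoSum_add_single 𝒱.N (fun _ => ((1 : ℝ) : ℂ)) j 1
    rw [one_smul] at this
    rw [← this]
    congr 1
    ext i
    by_cases hi : i = j <;> simp [hi]
  rw [h3] at h2
  simpa using sub_mem h2 h1

theorem Variation.IsLimit.inCompactDual {D : PolarizedData E} {𝒱 : Variation D r}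
    {Finf : ℤ → Submodule ℂ E} (h : 𝒱.IsLimit Finf) : D.InCompactDual Finf := by
  obtain ⟨ψ, -, hψ, -, rfl⟩ := h
  exact hψ 0 fun j => by simp

end HodgeLimit

open HodgeLimit
theorem mainTheorem7 {E : Type*} [NormedAddCommGroup E] [NormedSpace ℂ E]
    [FiniteDimensional ℂ E] {r : ℕ} (D : PolarizedData E) (𝒱 : Variation D r)
    (Finf M : ℤ → Submodule ℂ E) (hadm : 𝒱.IsAdmissible Finf M)
    (I : ℤ → ℤ → Submodule ℂ E) (hI : IsDeligneBigrading D Finf M I)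
    (Γ : (Fin r → ℂ) → E →L[ℂ] E) (hΓ : 𝒱.IsLocalNormalForm Finf I Γ)
    (z : (Fin r → ℂ) → Fin r → ℂ) (hz : IsBranchChoice z) :
    Tendsto (fun s => adExp (monoSum 𝒱.N (z s)) (Γ s)) (𝓝[puncturedPolydisc r] 0) (𝓝 0) := by
  have := FiniteDimensional.complete ℂ E
  obtain ⟨hΓ0, ρ₀, hρ₀, hd₀, hq, hF₀⟩ := hΓ
  -- The cap at `1` keeps points off the divisor inside the punctured unit polydisc, where
  -- horizontality is available.
  set ρ := min ρ₀ 1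
  have hρ : 0 < ρ := lt_min hρ₀ one_pos
  have hsub : polydisc r ρ ⊆ polydisc r ρ₀ := fun s hs j => (hs j).trans_le (min_le_left _ _)
  have hd := hd₀.mono hsub
  have hF := fun w hw hwρ => hF₀ w hw (hsub hwρ)
  have hres := fun (s : Fin r → ℂ) (hs : s ∈ polydisc r ρ) (j : Fin r) (hsj : s j = 0) =>
    residue_horizontal (min_le_right _ _) hd hF hs hsj
  have hlim := hadm.limit.inCompactDual
  refine tendsto_adExp_of_commute 𝒱.N_comm 𝒱.N_nilp hρ hd hΓ0 (fun j s hs hsj => ?_) hz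
  -- This is the residue statement at the origin, where `Γ` vanishes.
  have hNF : ∀ p, ∀ v ∈ Finf p, 𝒱.N j v ∈ Finf (p - 1) := fun p v hv => by
    simpa [hΓ0] using hres 0 (fun i => by simpa using hρ) j rfl p hv
  exact hI.commute_of_conj_shift hlim.top hlim.bot
    (fun p v hv => map_opposite_of_mem_qSub (hq s (hsub hs)) p hv) hNF
    (fun p v hv => hI.map_opposite (𝒱.N_real j) hNF
      (fun k v hv => hadm.shift_weight j k hv) p hv)
    (fun p v hv => hres s hs j hsj p hv)
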